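/- Let $n\ge 2$ and $\mathcal N=\{1,\dots,n\}$, and let $\mathcal N'=\{1',\dots,n'\}$ be a disjoint copy of $\mathcal N$. Let $\mathcal I^{\ast}_n$ be the dual symmetric inverse semigroup: its elements are the partitions of $\mathcal N\cup\mathcal N'$ all of whose blocks meet both $\mathcal N$ and $\mathcal N'$. The product $\alpha\beta$ is obtained by identifying each bottom vertex $i'$ of $\alpha$ with the top vertex $i$ of $\beta$, taking the connected components of the resulting diagram on three rows, and restricting them to the top vertices of $\alpha$ and the bottom vertices of $\beta$. The rank of an element is its number of blocks. The symmetric group $\mathcal S_n$ is embedded in $\mathcal I^{\ast}_n$ as the set of partitions of the form $\{\{x,g(x)'\}: x\in\mathcal N\}$, where $g$ is a permutation of $\mathcal N$. For an idempotent $e$, let $G(e)$ be the maximal subgroup of $\mathcal I^{\ast}_n$ with identity element $e$. A (nonempty) subsemigroup $T$ of a semigroup $S$ is called isolated if for all $a\in S$ and all $k\ge 1$, $a^k\in T$ implies $a\in T$. Theorem. The sets $\mathcal I^{\ast}_n$, $\mathcal S_n$, $\mathcal I^{\ast}_n\setminus\mathcal S_n$, and $G(e)$ for every idempotent $e\in\mathcal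 I^{\ast}_n$ of rank $n-1$, are isolated subsemigroups of $\mathcal I^{\ast}_n$, and every isolated subsemigroup of $\mathcal I^{\ast}_n$ is one of these. -/

import Mathlib

/-- A partition of the disjoint union `X ∪ X'` into nonempty blocks, given by its equivalence
relation. The top vertex `x` is `Sum.inl x`, the bottom vertex `x'` is `Sum.inr x`. -/
@[ext]
structure TwoRowPartition (X : Type*) where
  rel : Setoid (X ⊕ X)

namespace TwoRowPartition

variable {X : Type*}

/-- Three rows of vertices are `X ⊕ (X ⊕ X)` (top, middle, bottom).
`upper` places a two-row diagram on the top and middle rows. -/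
def upper : X ⊕ X → X ⊕ (X ⊕ X) := Sum.map id Sum.inl

/-- `lower` places a two-row diagram on the middle and bottom rows. -/
def lower : X ⊕ X → X ⊕ (X ⊕ X) := Sum.inr

/-- `outer` is the inclusion of the top and bottom rows. -/
def outer : X ⊕ X → X ⊕ (X ⊕ X) := Sum.map id Sum.inr

/-- The natural multiplication: identify the bottom vertices of `α` with the corresponding top
vertices of `β`, take the connected components (the least equivalence relation on the three rows
that contains both diagrams), and restrict to the top and the bottom row. -/
instance : Mul (TwoRowPartition X) where
  mul α β := ⟨Setoid.comap outer (Setoid.map α.rel upper ⊔ Setoid.map β.rel lower)⟩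

/-- The identity: the blocks are the pairs `{x, x'}`. -/
instance : One (TwoRowPartition X) where
  one := ⟨Setoid.ker (Sum.elim id id)⟩

theorem rel_mul (α β : TwoRowPartition X) : (α * β).rel =
    Setoid.comap outer (Setoid.map α.rel upper ⊔ Setoid.map β.rel lower) := rfl

theorem rel_one : (1 : TwoRowPartition X).rel = Setoid.ker (Sum.elim id id) := rfl

theorem map_le_iff {A B : Type*} {r : Setoid A} {f : A → B} {s : Setoid B} :
    Setoid.map r f ≤ s ↔ r ≤ Setoid.comap f s := by
  constructor
  · intro h a b hab
    exact h (Setoid.le_comap_map hab)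
  · intro h
    apply Setoid.eqvGen_le
    rintro x y ⟨a, b, hab, rfl, rfl⟩
    exact h hab

theorem map_sup' {A B : Type*} (r s : Setoid A) (f : A → B) :
    Setoid.map (r ⊔ s) f = Setoid.map r f ⊔ Setoid.map s f :=
  eq_of_forall_ge_iff fun c => by
    rw [map_le_iff, sup_le_iff, sup_le_iff, map_le_iff, map_le_iff]

theorem map_map' {A B C : Type*} (r : Setoid A) (f : A → B) (g : B → C) :
    Setoid.map (Setoid.map r f) g = Setoid.map r (g ∘ f) :=
  eq_of_forall_ge_iff fun c => by
    rw [map_le_iff, map_le_iff, map_le_iff, Setoid.comap_comp]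

theorem map_rel_iff {A B : Type*} {r : Setoid A} {f : A → B} (hf : Function.Injective f)
    {x y : B} : Setoid.map r f x y ↔ (∃ a b, r a b ∧ f a = x ∧ f b = y) ∨ x = y := by
  rw [Setoid.coe_map_of_ker_le _ _ ((Setoid.ker_eq_bot_iff.2 hf).trans_le bot_le)]
  rfl

/-- Gluing along a subset and restricting to it commute. -/
theorem comap_sup_map {V W : Type*} (j : V → W) (K : Setoid W) (L : Setoid V) :
    Setoid.comap j (K ⊔ Setoid.map L j) = Setoid.comap j K ⊔ L := by
  apply le_antisymm
  · let M : Setoid V := Setoid.comap j K ⊔ L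
    have hK : ∀ {a b}, K (j a) (j b) → M a b := fun h =>
      (le_sup_left : Setoid.comap j K ≤ M) h
    have hL : ∀ {a b}, L a b → M a b := fun h => (le_sup_right : L ≤ M) h
    let S : Setoid W :=
      { r := fun u v => K u v ∨ ∃ a b, K u (j a) ∧ M a b ∧ K (j b) v
        iseqv :=
          { refl := fun u => Or.inl (K.refl' u)
            symm := by
              rintro u v (h | ⟨a, b, h1, h2, h3⟩)
              · exact Or.inl (K.symm' h)
              · exact Or.inr ⟨b, a, K.symm' h3, M.symm' h2, K.symm' h1⟩
            trans := by
              rintro u v w (h | ⟨a, b, h1, h2, h3⟩) (h' | ⟨c, d, h4, h5, h6⟩)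
              · exact Or.inl (K.trans' h h')
              · exact Or.inr ⟨c, d, K.trans' h h4, h5, h6⟩
              · exact Or.inr ⟨a, b, h1, h2, K.trans' h3 h'⟩
              · exact Or.inr ⟨a, d, h1,
                  M.trans' h2 (M.trans' (hK (K.trans' h3 h4)) h5), h6⟩ } }
    have hS : K ⊔ Setoid.map L j ≤ S := by
      refine sup_le (fun _ _ h => Or.inl h) (map_le_iff.2 ?_)
      intro a b h
      exact Or.inr ⟨a, b, K.refl' _, hL h, K.refl' _⟩
    intro u v h
    rcases hS h with h | ⟨a, b, h1, h2, h3⟩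
    · exact hK h
    · exact M.trans' (hK h1) (M.trans' h2 (hK h3))
  · refine sup_le ?_ ?_
    · intro a b h
      exact (le_sup_left : K ≤ K ⊔ Setoid.map L j) h
    · exact map_le_iff.1 le_sup_right

/-- Restriction commutes with extension by equality, for a pullback square of injections. -/
theorem comap_map_square {A B C D : Type*} {f : A → B} {g : A → C} {h : B → D} {k : C → D}
    (hg : Function.Injective g) (hh : Function.Injective h) (hk : Function.Injective k)
    (comm : ∀ a, h (f a) = k (g a)) (pull : ∀ b c, h b = k c → ∃ a, f a = b ∧ g a = c)
    (M : Setoid B) : Setoid.comap k (Setoid.map M h) = Setoid.map (Setoid.comap f M) g := by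
  apply Setoid.ext
  intro x y
  rw [Setoid.comap_rel, map_rel_iff hh, map_rel_iff hg]
  constructor
  · rintro (⟨a, b, hab, ha, hb⟩ | hxy)
    · obtain ⟨a, rfl, rfl⟩ := pull _ _ ha
      obtain ⟨b, rfl, rfl⟩ := pull _ _ hb
      exact Or.inl ⟨a, b, hab, rfl, rfl⟩
    · exact Or.inr (hk hxy)
  · rintro (⟨a, b, hab, rfl, rfl⟩ | rfl)
    · exact Or.inl ⟨f a, f b, hab, comm a, comm b⟩
    · exact Or.inr rfl

theorem upper_injective : Function.Injective (upper : X ⊕ X → _) :=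
  Sum.map_injective.2 ⟨Function.injective_id, Sum.inl_injective⟩

theorem lower_injective : Function.Injective (lower : X ⊕ X → _) := Sum.inr_injective

theorem outer_injective : Function.Injective (outer : X ⊕ X → _) :=
  Sum.map_injective.2 ⟨Function.injective_id, Sum.inr_injective⟩

theorem one_mul' (β : TwoRowPartition X) : 1 * β = β := by
  apply TwoRowPartition.ext
  rw [rel_mul]
  apply le_antisymm
  · let ret : X ⊕ (X ⊕ X) → X ⊕ X := Sum.elim Sum.inl id
    have h : Setoid.map (1 : TwoRowPartition X).rel upper ⊔ Setoid.map β.rel lower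
        ≤ Setoid.comap ret β.rel := by
      refine sup_le (map_le_iff.2 ?_) (map_le_iff.2 ?_)
      · rintro (a | a) (b | b) (hab : a = b) <;> subst hab <;> exact β.rel.refl' _
      · intro a b hab
        exact hab
    rintro (a | a) (b | b) hab <;> exact h hab
  · have key : ∀ a, (Setoid.map (1 : TwoRowPartition X).rel upper ⊔ Setoid.map β.rel lower)
        (outer a) (lower a) := by
      rintro (a | a)
      · have : (1 : TwoRowPartition X).rel (Sum.inl a) (Sum.inr a) := rfl
        exact (le_sup_left : _ ≤ Setoid.map (1 : TwoRowPartition X).rel upper ⊔ _)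
          (Setoid.le_comap_map this)
      · exact Setoid.refl' _ _
    intro a b hab
    rw [Setoid.comap_rel]
    refine Setoid.trans' _ (key a) (Setoid.trans' _ ?_ (Setoid.symm' _ (key b)))
    exact (le_sup_right : Setoid.map β.rel lower ≤ _) (Setoid.le_comap_map hab)

theorem mul_one' (β : TwoRowPartition X) : β * 1 = β := by
  apply TwoRowPartition.ext
  rw [rel_mul]
  apply le_antisymm
  · let ret : X ⊕ (X ⊕ X) → X ⊕ X := Sum.elim Sum.inl (Sum.elim Sum.inr Sum.inr)
    have h : Setoid.map β.rel upper ⊔ Setoid.map (1 : TwoRowPartition X).rel lower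
        ≤ Setoid.comap ret β.rel := by
      refine sup_le (map_le_iff.2 ?_) (map_le_iff.2 ?_)
      · rintro (a | a) (b | b) hab <;> exact hab
      · rintro (a | a) (b | b) (hab : a = b) <;> subst hab <;> exact β.rel.refl' _
    rintro (a | a) (b | b) hab <;> exact h hab
  · have key : ∀ a, (Setoid.map β.rel upper ⊔ Setoid.map (1 : TwoRowPartition X).rel lower)
        (outer a) (upper a) := by
      rintro (a | a)
      · exact Setoid.refl' _ _
      · have : (1 : TwoRowPartition X).rel (Sum.inr a) (Sum.inl a) := rfl
        exact (le_sup_right : Setoid.map (1 : TwoRowPartition X).rel lower ≤ _)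
          (Setoid.le_comap_map this)
    intro a b hab
    rw [Setoid.comap_rel]
    refine Setoid.trans' _ (key a) (Setoid.trans' _ ?_ (Setoid.symm' _ (key b)))
    exact (le_sup_left : Setoid.map β.rel upper ≤ _) (Setoid.le_comap_map hab)

theorem mul_assoc' (α β γ : TwoRowPartition X) : α * β * γ = α * (β * γ) := by
  -- Four rows are `X ⊕ (X ⊕ (X ⊕ X))`; `r123`, `r134`, `r234`, `r124` include three of them.
  let r123 : X ⊕ (X ⊕ X) → X ⊕ (X ⊕ (X ⊕ X)) := Sum.map id (Sum.map id Sum.inl)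
  let r134 : X ⊕ (X ⊕ X) → X ⊕ (X ⊕ (X ⊕ X)) := Sum.map id Sum.inr
  let r234 : X ⊕ (X ⊕ X) → X ⊕ (X ⊕ (X ⊕ X)) := Sum.inr
  let r124 : X ⊕ (X ⊕ X) → X ⊕ (X ⊕ (X ⊕ X)) := Sum.map id (Sum.map id Sum.inr)
  have i123 : Function.Injective r123 :=
    Sum.map_injective.2 ⟨Function.injective_id,
      Sum.map_injective.2 ⟨Function.injective_id, Sum.inl_injective⟩⟩
  have i134 : Function.Injective r134 :=
    Sum.map_injective.2 ⟨Function.injective_id, Sum.inr_injective⟩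
  have i234 : Function.Injective r234 := Sum.inr_injective
  have i124 : Function.Injective r124 :=
    Sum.map_injective.2 ⟨Function.injective_id,
      Sum.map_injective.2 ⟨Function.injective_id, Sum.inr_injective⟩⟩
  have e1 : r134 ∘ lower = r234 ∘ lower := by
    funext a; rcases a with a | a <;> rfl
  have e2 : r123 ∘ lower = r234 ∘ upper := by
    funext a; rcases a with a | a <;> rfl
  have e3 : r124 ∘ upper = r123 ∘ upper := by
    funext a; rcases a with a | a <;> rfl
  have e4 : (r134 ∘ outer : X ⊕ X → _) = r124 ∘ outer := by
    funext a; rcases a with a | a <;> rfl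
  have s1 : ∀ M : Setoid (X ⊕ (X ⊕ X)), Setoid.comap r134 (Setoid.map M r123) =
      Setoid.map (Setoid.comap outer M) upper := fun M =>
    comap_map_square upper_injective i123 i134
      (by rintro (a | a) <;> rfl)
      (by
        rintro (b | b | b) (c | c | c) h <;>
          simp [r123, r134, outer, upper] at h ⊢ <;> exact h) M
  have s2 : ∀ M : Setoid (X ⊕ (X ⊕ X)), Setoid.comap r124 (Setoid.map M r234) =
      Setoid.map (Setoid.comap outer M) lower := fun M =>
    comap_map_square lower_injective i234 i124
      (by rintro (a | a) <;> rfl)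
      (by
        rintro (b | b | b) (c | c | c) h <;>
          simp [r234, r124, outer, lower] at h ⊢ <;> exact h.symm) M
  apply TwoRowPartition.ext
  calc (α * β * γ).rel
      = Setoid.comap outer (Setoid.comap r134
          (Setoid.map (Setoid.map α.rel upper ⊔ Setoid.map β.rel lower) r123 ⊔
            Setoid.map (Setoid.map γ.rel lower) r134)) := by
        rw [comap_sup_map, s1, rel_mul (α * β), rel_mul α β]
    _ = Setoid.comap (r134 ∘ outer) (Setoid.map α.rel (r123 ∘ upper) ⊔
          Setoid.map β.rel (r123 ∘ lower) ⊔ Setoid.map γ.rel (r134 ∘ lower)) := by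
        rw [map_sup', map_map', map_map', map_map']
        rfl
    _ = Setoid.comap (r124 ∘ outer) (Setoid.map β.rel (r234 ∘ upper) ⊔
          Setoid.map γ.rel (r234 ∘ lower) ⊔ Setoid.map α.rel (r124 ∘ upper)) := by
        rw [e1, e2, e3, e4, sup_assoc, sup_comm]
    _ = Setoid.comap outer (Setoid.comap r124
          (Setoid.map (Setoid.map β.rel upper ⊔ Setoid.map γ.rel lower) r234 ⊔
            Setoid.map (Setoid.map α.rel upper) r124)) := by
        rw [map_sup', map_map', map_map', map_map']
        rfl
    _ = (α * (β * γ)).rel := by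
        rw [comap_sup_map, s2, rel_mul α (β * γ), rel_mul β γ, sup_comm]

/-- The monoid of all partitions of `X ∪ X'` under the natural multiplication. -/
instance : Monoid (TwoRowPartition X) where
  mul_assoc := mul_assoc'
  one_mul := one_mul'
  mul_one := mul_one'

/-- A generalised line is a set of vertices that meets both rows. -/
def IsGeneralisedLine (A : Set (X ⊕ X)) : Prop :=
  (∃ x, Sum.inl x ∈ A) ∧ (∃ y, Sum.inr y ∈ A)

/-- All blocks are generalised lines. -/
def HasOnlyGeneralisedLines (α : TwoRowPartition X) : Prop :=
  ∀ A ∈ α.rel.classes, IsGeneralisedLine A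

theorem hasOnlyGeneralisedLines_iff {α : TwoRowPartition X} : α.HasOnlyGeneralisedLines ↔
    (∀ x, ∃ y, α.rel (Sum.inl x) (Sum.inr y)) ∧ (∀ y, ∃ x, α.rel (Sum.inl x) (Sum.inr y)) := by
  constructor
  · intro h
    constructor
    · intro x
      obtain ⟨-, y, hy⟩ := h _ (α.rel.mem_classes (Sum.inl x))
      exact ⟨y, α.rel.symm' hy⟩
    · intro y
      obtain ⟨⟨x, hx⟩, -⟩ := h _ (α.rel.mem_classes (Sum.inr y))
      exact ⟨x, hx⟩
  · rintro ⟨h1, h2⟩ A ⟨a | a, rfl⟩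
    · obtain ⟨y, hy⟩ := h1 a
      exact ⟨⟨a, α.rel.refl' _⟩, ⟨y, α.rel.symm' hy⟩⟩
    · obtain ⟨x, hx⟩ := h2 a
      exact ⟨⟨x, hx⟩, ⟨a, α.rel.refl' _⟩⟩

theorem mul_rel_of_rel {α β : TwoRowPartition X} {x y z : X}
    (h : α.rel (Sum.inl x) (Sum.inr y)) (h' : β.rel (Sum.inl y) (Sum.inr z)) :
    (α * β).rel (Sum.inl x) (Sum.inr z) := by
  rw [rel_mul, Setoid.comap_rel]
  have h1 := (le_sup_left : _ ≤ Setoid.map α.rel upper ⊔ Setoid.map β.rel lower)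
    (Setoid.le_comap_map h)
  have h2 := (le_sup_right : _ ≤ Setoid.map α.rel upper ⊔ Setoid.map β.rel lower)
    (Setoid.le_comap_map h')
  exact Setoid.trans' _ h1 h2

end TwoRowPartition

/-- The dual symmetric inverse semigroup on `X`: the partitions of `X ∪ X'` all of whose blocks
are generalised lines, under the natural multiplication. -/
def DualSymInv (X : Type*) : Submonoid (TwoRowPartition X) where
  carrier := {α | α.HasOnlyGeneralisedLines}
  mul_mem' := by
    intro α β hα hβ
    rw [Set.mem_ofPred_eq, TwoRowPartition.hasOnlyGeneralisedLines_iff] at hα hβ ⊢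
    constructor
    · intro x
      obtain ⟨y, hy⟩ := hα.1 x
      obtain ⟨z, hz⟩ := hβ.1 y
      exact ⟨z, TwoRowPartition.mul_rel_of_rel hy hz⟩
    · intro z
      obtain ⟨y, hy⟩ := hβ.2 z
      obtain ⟨x, hx⟩ := hα.2 y
      exact ⟨x, TwoRowPartition.mul_rel_of_rel hx hy⟩
  one_mem' := TwoRowPartition.hasOnlyGeneralisedLines_iff.2
    ⟨fun x => ⟨x, rfl⟩, fun x => ⟨x, rfl⟩⟩

namespace DualSymInv

variable {X : Type*}

/-- The rank of an element is the number of its generalised lines. -/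
noncomputable def rank (α : DualSymInv X) : ℕ :=
  {A ∈ α.1.rel.classes | TwoRowPartition.IsGeneralisedLine A}.ncard

/-- The element with blocks `{x, g(x)'}`, for a permutation `g` of `X`. -/
def ofPerm (g : Equiv.Perm X) : DualSymInv X :=
  ⟨⟨Setoid.ker (Sum.elim g id)⟩, TwoRowPartition.hasOnlyGeneralisedLines_iff.2
    ⟨fun x => ⟨g x, rfl⟩, fun y => ⟨g.symm y, g.apply_symm_apply y⟩⟩⟩

/-- The symmetric group on `X` inside the dual symmetric inverse semigroup. -/
def symmetricGroup (X : Type*) : Set (DualSymInv X) := Set.range ofPerm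

end DualSymInv

/-- A subset `T` of a monoid is an isolated subsemigroup if it is nonempty and closed under
multiplication, and contains every element some positive power of which lies in `T`. -/
def IsIsolatedSubsemigroup {S : Type*} [Monoid S] (T : Set S) : Prop :=
  T.Nonempty ∧ (∀ a ∈ T, ∀ b ∈ T, a * b ∈ T) ∧ ∀ (a : S) (k : ℕ), 1 ≤ k → a ^ k ∈ T → a ∈ T

/-- The maximal subgroup `G(e)` with identity element the idempotent `e`: the group of units
of the monoid `eSe`. -/
def maximalSubgroup {S : Type*} [Monoid S] (e : S) : Set S :=
  {a | e * a = a ∧ a * e = a ∧ ∃ b, e * b = b ∧ b * e = b ∧ a * b = e ∧ b * a = e}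

/-! Idempotents of the semigroup are exactly the elements `ofSetoid φ`, and they multiply by joining
equivalence relations. By finiteness every element has an idempotent power, so an isolated
subsemigroup `T` is determined by the set of `φ` with `ofSetoid φ ∈ T`. This set is closed under
joins, hence has a greatest element `φ`.

If `φ = ⊤`, descent gives every nontrivial relation. For an involution `g` and the idempotent `e` of
`ε`, the squares of `ge` and `eg` are the idempotent of `ε` joined with its `g`-translate. If that
lies in `T`, so do `ge`, `eg` and `(eg)(ge) = e` (`ofSetoid_mem_of_involution`). Thus `T` is
everything or the set of non-units.

If `φ ≠ ⊤`, no smaller `ε` occurs: a permutation of `ε`-classes, multiplied by the idempotent of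
`φ`, would produce a relation not below `φ` (`exists_ofSetoid_mem_not_le`). So `φ` is the only
relation. For `φ = ⊥` this gives the units. Otherwise `φ` must be an atom, since a non-atom is the
join of a smaller relation and its translate under an involution (`exists_ofSetoid_mem_lt`); atoms
are the relations with `n - 1` classes, and `T` is the maximal subgroup. -/

namespace DualSymInv

/-! ### Lines of a diagram and the equivalences on its rows -/

open TwoRowPartition

variable {X : Type*}

/-- `Joins a x y` means that `x` and `y'` lie in the same block of `a`. -/
def Joins (a : DualSymInv X) (x y : X) : Prop := a.1.rel (Sum.inl x) (Sum.inr y)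

theorem exists_joins_right (a : DualSymInv X) (x : X) : ∃ y, Joins a x y :=
  (hasOnlyGeneralisedLines_iff.1 a.2).1 x

theorem exists_joins_left (a : DualSymInv X) (y : X) : ∃ x, Joins a x y :=
  (hasOnlyGeneralisedLines_iff.1 a.2).2 y

/-- The equivalence induced on the top row. -/
def topRel (a : DualSymInv X) : Setoid X := Setoid.comap Sum.inl a.1.rel

/-- The equivalence induced on the bottom row. -/
def botRel (a : DualSymInv X) : Setoid X := Setoid.comap Sum.inr a.1.rel

theorem topRel_of_joins {a : DualSymInv X} {x x' y : X} (h : Joins a x y) (h' : Joins a x' y) :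
    topRel a x x' :=
  a.1.rel.trans' h (a.1.rel.symm' h')

theorem botRel_of_joins {a : DualSymInv X} {x y y' : X} (h : Joins a x y) (h' : Joins a x y') :
    botRel a y y' :=
  a.1.rel.trans' (a.1.rel.symm' h) h'

theorem Joins.of_topRel {a : DualSymInv X} {x x' y : X} (h : Joins a x y) (h' : topRel a x' x) :
    Joins a x' y :=
  a.1.rel.trans' h' h

theorem Joins.of_botRel {a : DualSymInv X} {x y y' : X} (h : Joins a x y) (h' : botRel a y y') :
    Joins a x y' :=
  a.1.rel.trans' h h'

/-- An equivalence relation on the two rows of `a` that contains its lines contains `a`. -/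
theorem rel_le_of_joins (a : DualSymInv X) {r : Setoid (X ⊕ X)}
    (h : ∀ x y, Joins a x y → r (Sum.inl x) (Sum.inr y)) : a.1.rel ≤ r := by
  rintro (x | x) (y | y) hxy
  · obtain ⟨z, hz⟩ := exists_joins_right a y
    exact r.trans' (h x z (hz.of_topRel hxy)) (r.symm' (h y z hz))
  · exact h x y hxy
  · exact r.symm' (h y x (a.1.rel.symm' hxy))
  · obtain ⟨z, hz⟩ := exists_joins_left a x
    exact r.trans' (r.symm' (h z x hz)) (h z y (hz.of_botRel hxy))

theorem ext_joins {a b : DualSymInv X} (h : ∀ x y, Joins a x y ↔ Joins b x y) : a = b :=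
  Subtype.ext (TwoRowPartition.ext (le_antisymm
    (rel_le_of_joins a fun x y => (h x y).1) (rel_le_of_joins b fun x y => (h x y).2)))

theorem joins_mul {a b : DualSymInv X} {x y z : X} (h : Joins a x y) (h' : Joins b y z) :
    Joins (a * b) x z :=
  mul_rel_of_rel h h'

/-- Every block continues downwards through the second factor, so multiplication may merge top
vertices but never separates them. -/
theorem topRel_le_mul (a b : DualSymInv X) : topRel a ≤ topRel (a * b) := by
  intro x y h
  obtain ⟨z, hz⟩ := exists_joins_right a y
  obtain ⟨w, hw⟩ := exists_joins_right b z
  exact topRel_of_joins (joins_mul (hz.of_topRel h) hw) (joins_mul hz hw)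

theorem botRel_le_mul (a b : DualSymInv X) : botRel b ≤ botRel (a * b) := by
  intro x y h
  obtain ⟨z, hz⟩ := exists_joins_left b x
  obtain ⟨w, hw⟩ := exists_joins_left a z
  exact botRel_of_joins (joins_mul hw hz) (joins_mul hw (hz.of_botRel h))

/-- A labelling of the three rows that is compatible with the lines of both factors is compatible
with the lines of the product. -/
theorem rel_of_joins_mul {Y : Type*} {a b : DualSymInv X} (r : Setoid Y) (t m l : X → Y)
    (ha : ∀ x y, Joins a x y → r (t x) (m y)) (hb : ∀ y z, Joins b y z → r (m y) (l z))
    {x z : X} (h : Joins (a * b) x z) : r (t x) (l z) := by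
  have key : Setoid.map a.1.rel upper ⊔ Setoid.map b.1.rel lower ≤
      Setoid.comap (Sum.elim t (Sum.elim m l)) r :=
    sup_le
      (map_le_iff.2 (rel_le_of_joins (r := Setoid.comap upper (Setoid.comap _ r)) a ha))
      (map_le_iff.2 (rel_le_of_joins (r := Setoid.comap lower (Setoid.comap _ r)) b hb))
  exact key h

/-- The tool for computing products: the labelling bounds the product from above, and factoring each
line of `c` through one middle vertex bounds it from below. -/
theorem mul_eq_of_joins {Y : Type*} {a b c : DualSymInv X} (r : Setoid Y) (t m l : X → Y)
    (ha : ∀ x y, Joins a x y → r (t x) (m y)) (hb : ∀ y z, Joins b y z → r (m y) (l z))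
    (hc : ∀ x z, r (t x) (l z) → Joins c x z)
    (hc' : ∀ x z, Joins c x z → ∃ y, Joins a x y ∧ Joins b y z) : a * b = c :=
  ext_joins fun x z => ⟨fun h => hc x z (rel_of_joins_mul r t m l ha hb h), fun h => by
    obtain ⟨y, h1, h2⟩ := hc' x z h
    exact joins_mul h1 h2⟩

/-! ### Idempotents and inverses -/

/-- The idempotent of an equivalence relation: its blocks are `A ∪ A'` for the classes `A`. -/
def ofSetoid (φ : Setoid X) : DualSymInv X :=
  ⟨⟨Setoid.comap (Sum.elim id id) φ⟩, hasOnlyGeneralisedLines_iff.2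
    ⟨fun x => ⟨x, φ.refl' x⟩, fun y => ⟨y, φ.refl' y⟩⟩⟩

@[simp] theorem joins_ofSetoid {φ : Setoid X} {x y : X} : Joins (ofSetoid φ) x y ↔ φ x y := Iff.rfl

@[simp] theorem topRel_ofSetoid (φ : Setoid X) : topRel (ofSetoid φ) = φ := rfl

@[simp] theorem botRel_ofSetoid (φ : Setoid X) : botRel (ofSetoid φ) = φ := rfl

theorem ofSetoid_bot : ofSetoid (⊥ : Setoid X) = 1 := rfl

/-- A pair in `φ ⊔ ψ` may need a long alternating chain, so one middle vertex does not suffice.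
Instead the top relation of the product, being an equivalence, absorbs the join once it contains `φ`
and `ψ`. -/
theorem ofSetoid_mul (φ ψ : Setoid X) : ofSetoid φ * ofSetoid ψ = ofSetoid (φ ⊔ ψ) := by
  apply ext_joins
  intro x z
  constructor
  · exact rel_of_joins_mul (φ ⊔ ψ) id id id
      (fun _ _ h => (le_sup_left : φ ≤ φ ⊔ ψ) (joins_ofSetoid.1 h))
      (fun _ _ h => (le_sup_right : ψ ≤ φ ⊔ ψ) (joins_ofSetoid.1 h))
  · have hψ : ∀ {x z}, ψ x z → Joins (ofSetoid φ * ofSetoid ψ) x z := fun {x z} h =>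
      joins_mul (y := x) (φ.refl' x) h
    have : φ ⊔ ψ ≤ topRel (ofSetoid φ * ofSetoid ψ) :=
      sup_le (topRel_le_mul (ofSetoid φ) _)
        fun x y h => topRel_of_joins (hψ h) (hψ (ψ.refl' y))
    intro h
    exact (hψ (ψ.refl' z)).of_topRel (this h)

theorem isIdempotentElem_ofSetoid (φ : Setoid X) : IsIdempotentElem (ofSetoid φ) := by
  rw [IsIdempotentElem, ofSetoid_mul, sup_idem]

/-- The element obtained by exchanging the two rows. -/
def flip (a : DualSymInv X) : DualSymInv X :=
  ⟨⟨Setoid.comap Sum.swap a.1.rel⟩, hasOnlyGeneralisedLines_iff.2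
    ⟨fun x => (exists_joins_left a x).imp fun _ h => a.1.rel.symm' h,
      fun x => (exists_joins_right a x).imp fun _ h => a.1.rel.symm' h⟩⟩

@[simp] theorem joins_flip {a : DualSymInv X} {x y : X} : Joins (flip a) x y ↔ Joins a y x :=
  ⟨fun h => a.1.rel.symm' h, fun h => a.1.rel.symm' h⟩

@[simp] theorem flip_flip (a : DualSymInv X) : flip (flip a) = a :=
  ext_joins fun x y => by simp

theorem topRel_flip (a : DualSymInv X) : topRel (flip a) = botRel a := rfl

theorem mul_flip (a : DualSymInv X) : a * flip a = ofSetoid (topRel a) := by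
  refine mul_eq_of_joins a.1.rel Sum.inl Sum.inr Sum.inl (fun x y h => h)
    (fun y z h => h) (fun x z h => h) ?_
  intro x z h
  obtain ⟨y, hy⟩ := exists_joins_right a z
  exact ⟨y, hy.of_topRel h, joins_flip.2 hy⟩

theorem flip_mul (a : DualSymInv X) : flip a * a = ofSetoid (botRel a) := by
  simpa [topRel_flip] using mul_flip (flip a)

theorem ofSetoid_topRel_mul (a : DualSymInv X) : ofSetoid (topRel a) * a = a := by
  refine mul_eq_of_joins a.1.rel Sum.inl Sum.inl Sum.inr (fun x y h => h)
    (fun y z h => h) (fun x z h => h) ?_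
  intro x z h
  exact ⟨x, (topRel a).refl' x, h⟩

theorem mul_flip_mul (a : DualSymInv X) : a * flip a * a = a := by
  rw [mul_flip, ofSetoid_topRel_mul]

theorem mul_ofSetoid_botRel (a : DualSymInv X) : a * ofSetoid (botRel a) = a := by
  rw [← flip_mul, ← mul_assoc, mul_flip_mul]

theorem ofSetoid_mul_comm (φ ψ : Setoid X) :
    ofSetoid φ * ofSetoid ψ = ofSetoid ψ * ofSetoid φ := by
  rw [ofSetoid_mul, ofSetoid_mul, sup_comm]

/-- Every idempotent comes from an equivalence relation. -/
theorem eq_ofSetoid_of_isIdempotentElem {e : DualSymInv X} (he : IsIdempotentElem e) :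
    e = ofSetoid (topRel e) := by
  have he' : e * e = e := he
  -- In an inverse semigroup an idempotent is its own inverse: commutation of these two idempotents
  -- makes `flip e` and `e` both equal to their product.
  have hc : (flip e * e) * (e * flip e) = (e * flip e) * (flip e * e) := by
    rw [mul_flip, flip_mul, ofSetoid_mul_comm]
  have h1 : flip e = (e * flip e) * (flip e * e) := by
    rw [← hc, mul_assoc, ← mul_assoc e e, he', ← mul_assoc]
    simpa using (mul_flip_mul (flip e)).symm
  have h2 : e = (e * flip e) * (flip e * e) := by
    calc e = e * flip e * e := (mul_flip_mul e).symm
      _ = e * ((e * flip e) * (flip e * e)) * e := by rw [← h1]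
      _ = (e * e) * flip e * (flip e * (e * e)) := by simp only [mul_assoc]
      _ = _ := by rw [he']
  have h3 : flip e = e := h1.trans h2.symm
  have h4 := mul_flip e
  rwa [h3, he'] at h4

/-! ### Permutations, permutations of classes, and units -/

theorem ofPerm_mul (g h : Equiv.Perm X) : ofPerm g * ofPerm h = ofPerm (h * g) :=
  mul_eq_of_joins ⊥ (fun x => h (g x)) h id (fun _ _ e => congrArg h e) (fun _ _ e => e)
    (fun _ _ e => e) fun x _ e => ⟨g x, rfl, e⟩

theorem ofPerm_one : ofPerm (1 : Equiv.Perm X) = 1 := rfl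

/-- The conjugation rule for idempotents, in the form that moves a permutation past one. Both sides
have the lines `x`, `y'` with `φ (g x) y`. -/
theorem ofPerm_mul_ofSetoid (g : Equiv.Perm X) (φ : Setoid X) :
    ofPerm g * ofSetoid φ = ofSetoid (Setoid.comap g φ) * ofPerm g := by
  let c : DualSymInv X := ⟨⟨Setoid.comap (Sum.elim g id) φ⟩, hasOnlyGeneralisedLines_iff.2
    ⟨fun x => ⟨g x, φ.refl' _⟩, fun y => ⟨g.symm y, by
      change φ (g (g.symm y)) y
      rw [g.apply_symm_apply]⟩⟩⟩
  trans c
  · refine mul_eq_of_joins φ g id id ?_ (fun _ _ h => h) (fun _ _ h => h) fun x z h =>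
      ⟨g x, rfl, h⟩
    rintro x _ rfl
    exact φ.refl' _
  · symm
    refine mul_eq_of_joins φ g g id (fun _ _ h => h) ?_ (fun _ _ h => h) fun x z h =>
      ⟨g.symm z, ?_, g.apply_symm_apply z⟩
    · rintro x _ rfl
      exact φ.refl' (g x)
    · change φ (g x) (g (g.symm z))
      rwa [g.apply_symm_apply]

/-- The element of the maximal subgroup of `ofSetoid φ` that permutes the classes of `φ`
by `σ`. -/
def ofQuotientPerm {φ : Setoid X} (σ : Equiv.Perm (Quotient φ)) : DualSymInv X :=
  ⟨⟨Setoid.ker (Sum.elim (fun x => σ (Quotient.mk φ x)) (Quotient.mk φ))⟩,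
    hasOnlyGeneralisedLines_iff.2
      ⟨fun x => ⟨(σ (Quotient.mk φ x)).out, (Quotient.out_eq _).symm⟩,
        fun y => ⟨(σ.symm (Quotient.mk φ y)).out, by
          change σ (Quotient.mk φ (Quotient.out _)) = Quotient.mk φ y
          rw [Quotient.out_eq, σ.apply_symm_apply]⟩⟩⟩

theorem joins_ofQuotientPerm {φ : Setoid X} {σ : Equiv.Perm (Quotient φ)} {x y : X} :
    Joins (ofQuotientPerm σ) x y ↔ σ (Quotient.mk φ x) = Quotient.mk φ y := Iff.rfl

theorem ofQuotientPerm_mul {φ : Setoid X} (σ τ : Equiv.Perm (Quotient φ)) :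
    ofQuotientPerm σ * ofQuotientPerm τ = ofQuotientPerm (τ * σ) :=
  mul_eq_of_joins ⊥ (fun x => τ (σ (Quotient.mk φ x))) (fun x => τ (Quotient.mk φ x))
    (Quotient.mk φ) (fun _ _ e => congrArg τ e) (fun _ _ e => e) (fun _ _ e => e)
    fun x _ e => ⟨(σ (Quotient.mk φ x)).out, (Quotient.out_eq _).symm, by
      rw [joins_ofQuotientPerm, Quotient.out_eq]; exact e⟩

theorem ofQuotientPerm_one {φ : Setoid X} :
    ofQuotientPerm (1 : Equiv.Perm (Quotient φ)) = ofSetoid φ :=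
  ext_joins fun _ _ => Quotient.eq

theorem topRel_eq_bot_of_isUnit {a : DualSymInv X} (h : IsUnit a) : topRel a = ⊥ := by
  obtain ⟨u, rfl⟩ := h
  rw [eq_bot_iff]
  simpa [← ofSetoid_bot] using topRel_le_mul (u : DualSymInv X) ((u⁻¹ : _ˣ) : DualSymInv X)

theorem mem_symmetricGroup_iff_isUnit [Finite (DualSymInv X)] {a : DualSymInv X} :
    a ∈ symmetricGroup X ↔ IsUnit a := by
  constructor
  · rintro ⟨g, rfl⟩
    exact IsUnit.of_mul_eq_one (b := ofPerm g⁻¹)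
      (by rw [ofPerm_mul, inv_mul_cancel, ofPerm_one])
  · rintro ⟨u, rfl⟩
    -- Row relations only grow in products, and those of `1` are trivial; hence the lines of a unit
    -- form the graph of a bijection.
    have ht : topRel (u : DualSymInv X) ≤ ⊥ := (topRel_eq_bot_of_isUnit u.isUnit).le
    have hb : botRel (u : DualSymInv X) ≤ ⊥ := by
      simpa [← ofSetoid_bot] using botRel_le_mul ((u⁻¹ : _ˣ) : DualSymInv X) (u : DualSymInv X)
    choose f hf using exists_joins_right (u : DualSymInv X)
    have hbij : Function.Bijective f := by
      constructor
      · intro x y hxy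
        exact ht (topRel_of_joins (hf x) (hxy ▸ hf y))
      · intro y
        obtain ⟨x, hx⟩ := exists_joins_left (u : DualSymInv X) y
        exact ⟨x, hb (botRel_of_joins (hf x) hx)⟩
    refine ⟨Equiv.ofBijective f hbij, ext_joins fun x y => ?_⟩
    constructor
    · rintro rfl
      exact hf x
    · exact fun h => hb (botRel_of_joins (hf x) h)

instance [Finite X] : Finite (Setoid X) :=
  Finite.of_injective (fun r : Setoid X => (r : X → X → Prop)) fun _ _ h =>
    Setoid.eq_iff_rel_eq.2 h

instance [Finite X] : Finite (DualSymInv X) :=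
  Finite.of_injective (fun a : DualSymInv X => a.1.rel) fun _ _ h =>
    Subtype.ext (TwoRowPartition.ext h)

end DualSymInv


/-! ### Finite monoids and isolated subsemigroups -/

theorem exists_pow_isIdempotentElem {M : Type*} [Monoid M] [Finite M] (a : M) :
    ∃ k, 1 ≤ k ∧ IsIdempotentElem (a ^ k) := by
  obtain ⟨i, j, hij, h⟩ := Set.finite_univ.exists_lt_map_eq_of_forall_mem
    (f := fun n : ℕ => a ^ n) (fun _ => Set.mem_univ _)
  obtain ⟨d, rfl⟩ := Nat.exists_eq_add_of_lt hij
  have step : ∀ m t, i ≤ m → a ^ (m + t * (d + 1)) = a ^ m := by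
    intro m t hm
    obtain ⟨c, rfl⟩ := Nat.exists_eq_add_of_le hm
    induction t with
    | zero => simp
    | succ t ih =>
      rw [show i + c + (t + 1) * (d + 1) = (i + d + 1) + (c + t * (d + 1)) by ring, pow_add]
      rw [← h, ← pow_add, ← add_assoc, ih]
  -- The exponent is a multiple of the period `d + 1` and at least the preperiod `i`; `i + 1` keeps
  -- it positive when `i = 0`.
  refine ⟨(i + 1) * (d + 1), Nat.one_le_iff_ne_zero.2 (by positivity), ?_⟩
  rw [IsIdempotentElem, ← pow_add]
  exact step _ _ (by nlinarith)

section Monoid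

variable {M : Type*} [Monoid M]

theorem IsIsolatedSubsemigroup.pow_mem {T : Set M} (hT : IsIsolatedSubsemigroup T) {a : M}
    (ha : a ∈ T) {k : ℕ} (hk : 1 ≤ k) : a ^ k ∈ T := by
  induction k, hk using Nat.le_induction with
  | base => rwa [pow_one]
  | succ k _ ih => rw [pow_succ]; exact hT.2.1 _ ih _ ha

theorem IsIsolatedSubsemigroup.mem_iff_pow_mem {T : Set M} (hT : IsIsolatedSubsemigroup T) {a : M}
    {k : ℕ} (hk : 1 ≤ k) : a ∈ T ↔ a ^ k ∈ T :=
  ⟨fun ha => hT.pow_mem ha hk, hT.2.2 a k hk⟩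

theorem mul_mem_maximalSubgroup {e a b : M} (ha : a ∈ maximalSubgroup e)
    (hb : b ∈ maximalSubgroup e) : a * b ∈ maximalSubgroup e := by
  obtain ⟨ea, ae, a', ea', ae', aa', a'a⟩ := ha
  obtain ⟨eb, be, b', eb', be', bb', b'b⟩ := hb
  refine ⟨by rw [← mul_assoc, ea], by rw [mul_assoc, be], b' * a', by rw [← mul_assoc, eb'],
    by rw [mul_assoc, ae'], ?_, ?_⟩
  · rw [mul_assoc, ← mul_assoc b, bb', ea', aa']
  · rw [mul_assoc, ← mul_assoc a', a'a, eb, b'b]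

theorem self_mem_maximalSubgroup {e : M} (he : IsIdempotentElem e) : e ∈ maximalSubgroup e :=
  ⟨he, he, e, he, he, he, he⟩

theorem isIsolatedSubsemigroup_units [Finite M] : IsIsolatedSubsemigroup {a : M | IsUnit a} :=
  ⟨⟨1, isUnit_one⟩, fun _ ha _ hb => IsUnit.mul ha hb, fun _ _ hk h =>
    (isUnit_pow_iff (Nat.one_le_iff_ne_zero.1 hk)).1 h⟩

theorem isIsolatedSubsemigroup_compl_units [Finite M] (h : ∃ a : M, ¬ IsUnit a) :
    IsIsolatedSubsemigroup {a : M | IsUnit a}ᶜ :=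
  ⟨h, fun _ ha _ _ hab => ha (isUnit_of_mul_isUnit_left hab), fun _ k _ h hu => h (hu.pow k)⟩

end Monoid

/-! ### Maximal subgroups, rank and atoms -/

namespace DualSymInv

variable {X : Type*}

theorem isUnit_ofSetoid_iff {φ : Setoid X} : IsUnit (ofSetoid φ) ↔ φ = ⊥ :=
  ⟨fun h => topRel_eq_bot_of_isUnit h, fun h => by rw [h, ofSetoid_bot]; exact isUnit_one⟩

theorem topRel_le_pow (a : DualSymInv X) {k : ℕ} (hk : 1 ≤ k) : topRel a ≤ topRel (a ^ k) := by
  obtain ⟨m, rfl⟩ := Nat.exists_eq_add_of_le' hk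
  rw [pow_succ']
  exact topRel_le_mul _ _

theorem botRel_le_pow (a : DualSymInv X) {k : ℕ} (hk : 1 ≤ k) : botRel a ≤ botRel (a ^ k) := by
  obtain ⟨m, rfl⟩ := Nat.exists_eq_add_of_le' hk
  rw [pow_succ]
  exact botRel_le_mul _ _

theorem exists_pow_eq_ofSetoid [Finite X] (a : DualSymInv X) :
    ∃ k, 1 ≤ k ∧ ∃ ψ, a ^ k = ofSetoid ψ ∧ topRel a ≤ ψ ∧ botRel a ≤ ψ := by
  obtain ⟨k, hk, h⟩ := exists_pow_isIdempotentElem a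
  have h' := eq_ofSetoid_of_isIdempotentElem h
  refine ⟨k, hk, _, h', topRel_le_pow a hk, (botRel_le_pow a hk).trans_eq ?_⟩
  conv_lhs => rw [h']
  rw [botRel_ofSetoid]

theorem mem_maximalSubgroup_ofSetoid {φ : Setoid X} {a : DualSymInv X} :
    a ∈ maximalSubgroup (ofSetoid φ) ↔ topRel a = φ ∧ botRel a = φ := by
  constructor
  · rintro ⟨ea, ae, b, -, -, ab, ba⟩
    constructor
    · apply le_antisymm
      · simpa [ab] using topRel_le_mul a b
      · simpa [ea] using topRel_le_mul (ofSetoid φ) a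
    · apply le_antisymm
      · simpa [ba] using botRel_le_mul b a
      · simpa [ae] using botRel_le_mul a (ofSetoid φ)
  · rintro ⟨h1, h2⟩
    refine ⟨?_, ?_, flip a, ?_, ?_, ?_, ?_⟩
    · rw [← h1, ofSetoid_topRel_mul]
    · rw [← h2, mul_ofSetoid_botRel]
    · rw [← h2, ← topRel_flip, ofSetoid_topRel_mul]
    · rw [← h1, ← mul_flip, ← mul_assoc]
      simpa using mul_flip_mul (flip a)
    · rw [mul_flip, h1]
    · rw [flip_mul, h2]

/-- The row relations of `a` lie below those of `a ^ k`, which are the atom `φ`, so each is `⊥` or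
`φ`. The value `⊥` would make `flip a` a one-sided inverse, hence `a` and `a ^ k` units. -/
theorem isIsolatedSubsemigroup_maximalSubgroup [Finite X] {φ : Setoid X} (hφ : IsAtom φ) :
    IsIsolatedSubsemigroup (maximalSubgroup (ofSetoid φ)) := by
  refine ⟨⟨_, self_mem_maximalSubgroup (isIdempotentElem_ofSetoid φ)⟩,
    fun a ha b hb => mul_mem_maximalSubgroup ha hb, fun a k hk h => ?_⟩
  rw [mem_maximalSubgroup_ofSetoid] at h ⊢
  have hu : ¬ IsUnit a := fun hu => hφ.1 (by rw [← h.1, topRel_eq_bot_of_isUnit (hu.pow k)])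
  constructor
  · refine (hφ.le_iff.1 ((topRel_le_pow a hk).trans_eq h.1)).resolve_left fun h0 => hu ?_
    exact IsUnit.of_mul_eq_one (flip a) (by rw [mul_flip, h0, ofSetoid_bot])
  · refine (hφ.le_iff.1 ((botRel_le_pow a hk).trans_eq h.2)).resolve_left fun h0 => hu ?_
    exact IsUnit.of_mul_eq_one_right (flip a) (by rw [flip_mul, h0, ofSetoid_bot])

theorem rank_ofSetoid (φ : Setoid X) : rank (ofSetoid φ) = Nat.card (Quotient φ) := by
  have h1 : {A ∈ (ofSetoid φ).1.rel.classes | TwoRowPartition.IsGeneralisedLine A} =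
      (ofSetoid φ).1.rel.classes :=
    Set.sep_eq_self_iff_mem_true.2 (ofSetoid φ).2
  rw [rank, h1, ← Nat.card_coe_set_eq, ← Nat.card_congr (Setoid.quotientEquivClasses _)]
  have h2 : (ofSetoid φ).1.rel = Setoid.ker (Quotient.mk φ ∘ Sum.elim id id) :=
    Setoid.comap_eq
  rw [h2]
  exact Nat.card_congr (Setoid.quotientKerEquivOfSurjective _
    fun q => ⟨Sum.inl q.out, Quotient.out_eq q⟩)

theorem card_quotient_lt [Finite X] {φ ψ : Setoid X} (h : φ < ψ) :
    Nat.card (Quotient ψ) < Nat.card (Quotient φ) := by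
  obtain ⟨hle, hnle⟩ := h
  have hs : Function.Surjective (Setoid.map_of_le hle) :=
    fun q => ⟨Quotient.mk φ q.out, (Quotient.out_eq q)⟩
  refine lt_of_le_of_ne (Nat.card_le_card_of_surjective _ hs) fun hc => hnle fun x y hxy => ?_
  have hb := (Nat.bijective_iff_surjective_and_card _).2 ⟨hs, hc.symm⟩
  exact Quotient.exact (hb.1 (a₁ := Quotient.mk φ x) (a₂ := Quotient.mk φ y)
    (Quotient.sound (s := ψ) hxy))

theorem exists_ne_of_ne_bot {φ : Setoid X} (h : φ ≠ ⊥) : ∃ x y, x ≠ y ∧ φ x y := by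
  by_contra! hc
  exact h (eq_bot_iff.2 fun x y hxy => by_contra fun hne => hc x y hne hxy)

theorem isAtom_iff_card_quotient [Finite X] {φ : Setoid X} (hX : 1 ≤ Nat.card X) :
    IsAtom φ ↔ Nat.card (Quotient φ) = Nat.card X - 1 := by
  classical
  have hbot : Nat.card (Quotient (⊥ : Setoid X)) = Nat.card X :=
    Nat.card_congr Setoid.quotientBotEquiv
  constructor
  · intro h
    obtain ⟨x, y, hne, hxy⟩ := exists_ne_of_ne_bot h.1
    -- An atom identifies a single pair: it is the kernel of the map sending `y` to `x` and fixing
    -- the rest, whose range misses only `y`.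
    have hle : Setoid.ker (Function.update id y x) ≤ φ := by
      intro u v huv
      have key : ∀ w, φ w (Function.update id y x w) := by
        intro w
        by_cases hw : w = y
        · rw [hw, Function.update_self]; exact φ.symm' hxy
        · simp [hw]
      exact φ.trans' (key u) (φ.trans' (by rw [Setoid.ker_def.1 huv]) (φ.symm' (key v)))
    have hker : Setoid.ker (Function.update id y x) = φ := by
      refine (h.le_iff.1 hle).resolve_left fun h0 => hne ?_
      have : Setoid.ker (Function.update id y x) x y := by simp [Setoid.ker_def, hne]
      rwa [h0] at this
    have hrange : Set.range (Function.update id y x) = {y}ᶜ := by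
      ext w
      simp only [Set.mem_range, Set.mem_compl_iff, Set.mem_singleton_iff]
      constructor
      · rintro ⟨v, rfl⟩
        by_cases hv : v = y <;> simp [hv, hne]
      · intro hw
        exact ⟨w, by simp [hw]⟩
    rw [← hker, Nat.card_congr (Setoid.quotientKerEquivRange _), hrange, Nat.card_coe_set_eq,
      Set.ncard_compl, Set.ncard_singleton]
  · intro h
    refine ⟨?_, fun ψ hψ => ?_⟩
    · rintro rfl
      omega
    -- A chain `⊥ < ψ < φ` would lower the number of classes at least twice.
    · by_contra h0
      have h1 := card_quotient_lt hψ
      have h2 := card_quotient_lt (bot_lt_iff_ne_bot.2 h0)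
      omega

/-! ### Classification of isolated subsemigroups -/

section Isolated

variable {T : Set (DualSymInv X)}

/-- If the join of `ε` with its translate under an involution gives an idempotent of an isolated
subsemigroup, then so does `ε`. -/
theorem ofSetoid_mem_of_involution (hT : IsIsolatedSubsemigroup T) {ε : Setoid X}
    (g : Equiv.Perm X) (hg : g * g = 1) (h : ofSetoid (ε ⊔ Setoid.comap g ε) ∈ T) :
    ofSetoid ε ∈ T := by
  have hgg : ofPerm g * ofPerm g = 1 := by rw [ofPerm_mul, hg, ofPerm_one]
  have hc : Setoid.comap g (Setoid.comap g ε) = ε := by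
    rw [← Setoid.comap_comp, ← Equiv.Perm.coe_mul, hg]; rfl
  have h1 : ofPerm g * ofSetoid ε ∈ T := by
    apply hT.2.2 _ 2 one_le_two
    rwa [pow_two, ← mul_assoc, mul_assoc (ofPerm g) _ (ofPerm g),
      ← mul_one (ofPerm g * (ofSetoid ε * ofPerm g)), ← mul_assoc,
      ofPerm_mul_ofSetoid, mul_one, mul_assoc _ (ofPerm g) (ofPerm g), hgg, mul_one,
      ofSetoid_mul, sup_comm]
  have h2 : ofSetoid ε * ofPerm g ∈ T := by
    apply hT.2.2 _ 2 one_le_two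
    rwa [pow_two, mul_assoc, ← mul_assoc (ofPerm g), ofPerm_mul_ofSetoid, mul_assoc _ (ofPerm g),
      hgg, mul_one, ofSetoid_mul]
  have h3 := hT.2.1 _ h2 _ h1
  rwa [mul_assoc, ← mul_assoc (ofPerm g), hgg, one_mul, isIdempotentElem_ofSetoid] at h3

theorem ofSetoid_mem_of_top_mem [Finite X] (hT : IsIsolatedSubsemigroup T)
    (h : ofSetoid ⊤ ∈ T) (ε : Setoid X) (hε : ε ≠ ⊥) : ofSetoid ε ∈ T := by
  classical
  induction ε using WellFoundedGT.induction with
  | ind ε ih =>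
  by_cases htop : ε = ⊤
  · rwa [htop]
  obtain ⟨u, v, huv, huv'⟩ := exists_ne_of_ne_bot hε
  obtain ⟨z, hz⟩ : ∃ z, ¬ ε u z := by
    by_contra! hc
    exact htop (Setoid.eq_top_iff.2 fun x y => ε.trans' (ε.symm' (hc x)) (hc y))
  -- The swap carries the related pair `u`, `v` to `z`, `v`, which `ε` separates.
  have hlt : ε < ε ⊔ Setoid.comap (Equiv.swap u z) ε := by
    refine lt_of_le_of_ne le_sup_left fun heq => hz ?_
    have h1 : Setoid.comap (Equiv.swap u z) ε z v := by
      rw [Setoid.comap_rel, Equiv.swap_apply_right, Equiv.swap_apply_of_ne_of_ne huv.symm]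
      · exact huv'
      · rintro rfl; exact hz huv'
    have h2 : ε z v := by
      rw [heq]
      exact (le_sup_right : Setoid.comap (Equiv.swap u z) ε ≤ _) h1
    exact ε.trans' huv' (ε.symm' h2)
  exact ofSetoid_mem_of_involution hT (Equiv.swap u z) (Equiv.swap_mul_self u z)
    (ih _ hlt (ne_bot_of_gt hlt))

/-- If an isolated subsemigroup contains the idempotents of `ε < φ ≠ ⊤`, then it contains the
idempotent of some `ψ` that is not finer than `φ`. -/
theorem exists_ofSetoid_mem_not_le [Finite X] (hT : IsIsolatedSubsemigroup T) {ε φ : Setoid X}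
    (hε : ofSetoid ε ∈ T) (hφ : ofSetoid φ ∈ T) (hlt : ε < φ) (htop : φ ≠ ⊤) :
    ∃ ψ, ofSetoid ψ ∈ T ∧ ¬ ψ ≤ φ := by
  classical
  obtain ⟨hle, hnle⟩ := hlt
  obtain ⟨a, b, hab, hab'⟩ : ∃ a b, φ a b ∧ ¬ ε a b := by
    by_contra! hc
    exact hnle fun x y h => hc x y h
  obtain ⟨c, hc⟩ : ∃ c, ¬ φ a c := by
    by_contra! hc
    exact htop (Setoid.eq_top_iff.2 fun x y => φ.trans' (φ.symm' (hc x)) (hc y))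
  -- The class of `b` lies in the `φ`-class of `a`, that of `c` outside it. The square of the swap
  -- is the idempotent of `ε`.
  let σ : Equiv.Perm (Quotient ε) := Equiv.swap (Quotient.mk ε b) (Quotient.mk ε c)
  have hσ : ofQuotientPerm σ ∈ T := by
    apply hT.2.2 _ 2 one_le_two
    rwa [pow_two, ofQuotientPerm_mul, Equiv.swap_mul_self, ofQuotientPerm_one]
  have hu := hT.2.1 _ hφ _ hσ
  obtain ⟨k, hk, ψ, hψ, -, hbot⟩ := exists_pow_eq_ofSetoid (ofSetoid φ * ofQuotientPerm σ)
  refine ⟨ψ, hψ ▸ hT.pow_mem hu hk, fun hψφ => hc (hψφ (hbot ?_))⟩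
  -- The product joins `a` to `a'`, whose class is fixed, and to `c'` through `b`. Hence every power
  -- relates `a` and `c` on the bottom row.
  have h1 : Joins (ofSetoid φ * ofQuotientPerm σ) a a := by
    refine joins_mul (φ.refl' a) (joins_ofQuotientPerm.2 (Equiv.swap_apply_of_ne_of_ne ?_ ?_))
    · exact fun h => hab' (Quotient.exact h)
    · exact fun h => hc (hle (Quotient.exact h))
  have h2 : Joins (ofSetoid φ * ofQuotientPerm σ) a c :=
    joins_mul hab (joins_ofQuotientPerm.2 (Equiv.swap_apply_left _ _))
  exact botRel_of_joins h1 h2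

/-- An equivalence relation that is neither trivial nor an atom is preserved by an involution
that moves both members of some related pair `z`, `v` to elements other than `z`. -/
theorem exists_involution_of_not_isAtom {φ : Setoid X} (hbot : φ ≠ ⊥) (hφ : ¬ IsAtom φ) :
    ∃ (g : Equiv.Perm X) (z v : X), g * g = 1 ∧ φ ≤ Setoid.comap g φ ∧ φ z v ∧ z ≠ v ∧
      g z ≠ z ∧ g v ≠ z := by
  classical
  obtain ⟨ψ, hψφ, hψ⟩ : ∃ ψ < φ, ψ ≠ ⊥ := by
    by_contra! hc
    exact hφ ⟨hbot, hc⟩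
  obtain ⟨hle, hnle⟩ := hψφ
  obtain ⟨a, b, hab, hψab⟩ := exists_ne_of_ne_bot hψ
  obtain ⟨c, d, hcd, hψcd⟩ : ∃ c d, φ c d ∧ ¬ ψ c d := by
    by_contra! hc
    exact hnle fun x y h => hc x y h
  have hab' := hle hψab
  have hne : c ≠ d := by rintro rfl; exact hψcd (ψ.refl' c)
  have hs : ∀ {x y}, φ x y → φ y x := fun h => φ.symm' h
  have ht : ∀ {x y z}, φ x y → φ y z → φ x z := fun h h' => φ.trans' h h'
  -- If some class has three elements, swap two of them. Otherwise there are two classes `{a, b}`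
  -- and `{c, d}` of size two, which are exchanged.
  by_cases h3 : ∃ x y z, x ≠ y ∧ y ≠ z ∧ x ≠ z ∧ φ x y ∧ φ y z
  · obtain ⟨x, y, z, hxy, hyz, hxz, h1, h2⟩ := h3
    refine ⟨Equiv.swap x z, z, y, Equiv.swap_mul_self x z, ?_, hs h2, hyz.symm, ?_, ?_⟩
    · have key : ∀ w, φ w (Equiv.swap x z w) := by
        intro w
        rw [Equiv.swap_apply_def]
        split_ifs with hx hz
        · rw [hx]; exact ht h1 h2
        · rw [hz]; exact hs (ht h1 h2)
        · exact φ.refl' w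
      exact fun u w h => ht (hs (key u)) (ht h (key w))
    · rwa [Equiv.swap_apply_right]
    · rwa [Equiv.swap_apply_of_ne_of_ne hxy.symm hyz]
  · push Not at h3
    have huniq : ∀ x y z, φ x y → φ y z → x = y ∨ y = z ∨ x = z := by
      intro x y z h1 h2
      by_contra! hc
      exact h3 x y z hc.1 hc.2.1 hc.2.2 h1 h2
    have hψs : ∀ {x y}, ψ x y → ψ y x := fun h => ψ.symm' h
    have hac : a ≠ c := by grind
    have had : a ≠ d := by grind
    have hbc : b ≠ c := by grind
    have hbd : b ≠ d := by grind
    refine ⟨Equiv.swap a c * Equiv.swap b d, c, d, ?_, ?_, hcd, hne, ?_, ?_⟩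
    · ext w
      simp only [Equiv.Perm.mul_apply, Equiv.Perm.one_apply, Equiv.swap_apply_def]
      grind
    · intro u w h
      rw [Setoid.comap_rel]
      simp only [Equiv.Perm.mul_apply, Equiv.swap_apply_def]
      have := φ.refl' u
      grind
    · simp only [Equiv.Perm.mul_apply, Equiv.swap_apply_def]
      grind
    · simp only [Equiv.Perm.mul_apply, Equiv.swap_apply_def]
      grind

theorem exists_ofSetoid_mem_lt (hT : IsIsolatedSubsemigroup T) {φ : Setoid X}
    (hφ : ofSetoid φ ∈ T) (hbot : φ ≠ ⊥) (hatom : ¬ IsAtom φ) : ∃ ε < φ, ofSetoid ε ∈ T := by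
  obtain ⟨g, z, v, hgg, hg, hzv, hne, hgz, hgv⟩ := exists_involution_of_not_isAtom hbot hatom
  -- `ε` separates `z` from its class.
  let ε : Setoid X := φ ⊓ Setoid.ker (· = z)
  have hε : ∀ {x y}, ε x y ↔ φ x y ∧ (x = z) = (y = z) := Iff.rfl
  have hle : ε ≤ φ := inf_le_left
  have hgle : Setoid.comap g ε ≤ φ := by
    intro x y h
    have h1 := hg (hle h)
    have hg2 : ∀ w, g (g w) = w := fun w => Equiv.ext_iff.1 hgg w
    rwa [Setoid.comap_rel, hg2, hg2] at h1
  have hsup : ε ⊔ Setoid.comap g ε = φ := by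
    refine le_antisymm (sup_le hle hgle) fun x y hxy => ?_
    -- The relation `ε` isolates only `z`, and neither `g v` nor `g z` is `z`, so the translate
    -- still relates `v` to `z`.
    have hz : (ε ⊔ Setoid.comap g ε) v z := by
      refine (le_sup_right : Setoid.comap g ε ≤ _) ?_
      rw [Setoid.comap_rel, hε]
      exact ⟨hg (φ.symm' hzv), by simp [hgz, hgv]⟩
    have key : ∀ w, φ w z → (ε ⊔ Setoid.comap g ε) w z := by
      intro w hw
      by_cases hwz : w = z
      · rw [hwz]
      · refine Setoid.trans' _ ((le_sup_left : ε ≤ _) (hε.2 ⟨φ.trans' hw hzv, ?_⟩)) hz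
        simp [hwz, hne.symm]
    by_cases hx : φ x z
    · exact Setoid.trans' _ (key x hx) (Setoid.symm' _ (key y (φ.trans' (φ.symm' hxy) hx)))
    · refine (le_sup_left : ε ≤ _) (hε.2 ⟨hxy, ?_⟩)
      have h1 : x ≠ z := by rintro rfl; exact hx (φ.refl' x)
      have h2 : y ≠ z := by rintro rfl; exact hx hxy
      simp [h1, h2]
  refine ⟨ε, lt_of_le_of_ne hle fun heq => ?_, ofSetoid_mem_of_involution hT g hgg (by rwa [hsup])⟩
  rw [← heq, hε] at hzv
  simp [hne.symm] at hzv

theorem eq_of_isIsolatedSubsemigroup [Finite X] (hT : IsIsolatedSubsemigroup T) :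
    T = Set.univ ∨ T = {a | IsUnit a} ∨ T = {a | IsUnit a}ᶜ ∨
      ∃ φ : Setoid X, IsAtom φ ∧ T = maximalSubgroup (ofSetoid φ) := by
  obtain ⟨a, ha⟩ := hT.1
  obtain ⟨k, hk, ψ, hψ, -⟩ := exists_pow_eq_ofSetoid a
  have hne : {φ | ofSetoid φ ∈ T}.Nonempty := ⟨ψ, show ofSetoid ψ ∈ T from hψ ▸ hT.pow_mem ha hk⟩
  obtain ⟨φ, hφ, hmax⟩ := Set.Finite.exists_maximal (Set.toFinite _) hne
  have hφ' : ofSetoid φ ∈ T := hφ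
  -- Closure under joins turns the maximal `φ` into a greatest one.
  have hge : ∀ ψ, ofSetoid ψ ∈ T → ψ ≤ φ := by
    intro ψ hψ
    have h1 : ofSetoid (φ ⊔ ψ) ∈ T := by
      rw [← ofSetoid_mul]
      exact hT.2.1 _ hφ' _ hψ
    exact le_sup_right.trans (hmax h1 le_sup_left)
  have hunit : ∀ {b : DualSymInv X} {k ψ}, 1 ≤ k → b ^ k = ofSetoid ψ → (IsUnit b ↔ ψ = ⊥) := by
    intro b k ψ hk h
    rw [← isUnit_ofSetoid_iff, ← h, isUnit_pow_iff (Nat.one_le_iff_ne_zero.1 hk)]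
  by_cases htop : φ = ⊤
  · subst htop
    have hall := ofSetoid_mem_of_top_mem hT hφ'
    by_cases hbot : ofSetoid ⊥ ∈ T
    · left
      refine Set.eq_univ_of_forall fun b => ?_
      obtain ⟨k, hk, ψ, hψ, -⟩ := exists_pow_eq_ofSetoid b
      rw [hT.mem_iff_pow_mem hk, hψ]
      by_cases h : ψ = ⊥
      · rwa [h]
      · exact hall ψ h
    · right; right; left
      ext b
      obtain ⟨k, hk, ψ, hψ, -⟩ := exists_pow_eq_ofSetoid b
      rw [hT.mem_iff_pow_mem hk, Set.mem_compl_iff, Set.mem_ofPred_eq, hunit hk hψ, hψ]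
      exact ⟨by rintro h rfl; exact hbot h, hall ψ⟩
  have hmem : ∀ {b : DualSymInv X} {k ψ}, 1 ≤ k → b ^ k = ofSetoid ψ → (b ∈ T ↔ ψ = φ) := by
    intro b k ψ hk h
    rw [hT.mem_iff_pow_mem hk, h]
    refine ⟨fun hψ => ?_, fun h => h ▸ hφ'⟩
    by_contra hψφ
    obtain ⟨ψ', h1, h2⟩ :=
      exists_ofSetoid_mem_not_le hT hψ hφ' (lt_of_le_of_ne (hge ψ hψ) hψφ) htop
    exact h2 (hge ψ' h1)
  by_cases hbot : φ = ⊥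
  · subst hbot
    right; left
    ext b
    obtain ⟨k, hk, ψ, hψ, -⟩ := exists_pow_eq_ofSetoid b
    rw [hmem hk hψ, Set.mem_ofPred_eq, hunit hk hψ]
  · right; right; right
    have hatom : IsAtom φ := by
      by_contra h
      obtain ⟨ε, hlt, hε⟩ := exists_ofSetoid_mem_lt hT hφ' hbot h
      exact hlt.ne ((hmem le_rfl (pow_one _)).1 hε)
    refine ⟨φ, hatom, ?_⟩
    -- Both sets are isolated, so it suffices to compare their idempotents.
    have hG := isIsolatedSubsemigroup_maximalSubgroup hatom
    ext b
    obtain ⟨k, hk, ψ, hψ, -⟩ := exists_pow_eq_ofSetoid b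
    rw [hmem hk hψ, hG.mem_iff_pow_mem hk, hψ, mem_maximalSubgroup_ofSetoid]
    simp

end Isolated

end DualSymInv

open DualSymInv in
theorem isIsolatedSubsemigroup_dualSymInv_iff {X : Type*} [Finite X] [Nontrivial X]
    (T : Set (DualSymInv X)) :
    IsIsolatedSubsemigroup T ↔
      T = Set.univ ∨ T = symmetricGroup X ∨ T = (symmetricGroup X)ᶜ ∨
      ∃ e : DualSymInv X, IsIdempotentElem e ∧ rank e = Nat.card X - 1 ∧
        T = maximalSubgroup e := by
  have hS : symmetricGroup X = {a | IsUnit a} := Set.ext fun _ => mem_symmetricGroup_iff_isUnit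
  have hcard : 1 ≤ Nat.card X := Nat.card_pos
  rw [hS]
  constructor
  · intro hT
    refine (eq_of_isIsolatedSubsemigroup hT).imp_right (Or.imp_right (Or.imp_right ?_))
    rintro ⟨φ, hφ, h⟩
    exact ⟨ofSetoid φ, isIdempotentElem_ofSetoid φ,
      by rwa [rank_ofSetoid, ← isAtom_iff_card_quotient hcard], h⟩
  · rintro (rfl | rfl | rfl | ⟨e, he, hr, rfl⟩)
    · exact ⟨⟨1, trivial⟩, fun _ _ _ _ => trivial, fun _ _ _ _ => trivial⟩
    · exact isIsolatedSubsemigroup_units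
    · refine isIsolatedSubsemigroup_compl_units ⟨ofSetoid ⊤, fun h => ?_⟩
      obtain ⟨x, y, hxy⟩ := exists_pair_ne X
      have h1 : (⊤ : Setoid X) x y := trivial
      rw [isUnit_ofSetoid_iff.1 h] at h1
      exact hxy h1
    · rw [eq_ofSetoid_of_isIdempotentElem he] at hr ⊢
      rw [rank_ofSetoid, ← isAtom_iff_card_quotient hcard] at hr
      exact isIsolatedSubsemigroup_maximalSubgroup hr

theorem mainTheorem9 (n : ℕ) (hn : 2 ≤ n) (T : Set (DualSymInv (Fin n))) :
    IsIsolatedSubsemigroup T ↔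
      T = Set.univ ∨
      T = DualSymInv.symmetricGroup (Fin n) ∨
      T = (DualSymInv.symmetricGroup (Fin n))ᶜ ∨
      ∃ e : DualSymInv (Fin n), IsIdempotentElem e ∧ DualSymInv.rank e = n - 1 ∧
        T = maximalSubgroup e := by
  have : Nontrivial (Fin n) := Fin.nontrivial_iff_two_le.2 hn
  simpa using isIsolatedSubsemigroup_dualSymInv_iff T
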